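/- Let $N\ge 1$ and let $\mathcal H=\bigotimes_{k=1}^N\mathcal H_k$, where each $\mathcal H_k$ is a finite-dimensional complex Hilbert space. For each $k$ let $H_k$ be a Hermitian operator on $\mathcal H_k$, and let $$H=\sum_{k=1}^N H_k\otimes\bigotimes_{\ell\ne k} I_\ell .$$ For a density matrix $\rho$ with orthonormal eigenbasis $|i\rangle$ and eigenvalues $\lambda_i$, the quantum Fisher information with respect to a Hermitian operator $K$ is $$F_Q[\rho,K]=2\sum_{i,j:\ \lambda_i+\lambda_j>0}\frac{(\lambda_i-\lambda_j)^2}{\lambda_i+\lambda_j}\,|\langle i|K|j\rangle|^2 ,$$ and $F_Q^{\max}[H_k]=\sup_\sigma F_Q[\sigma,H_k]$, the supremum being over all density matrices $\sigma$ on $\mathcal H_k$. Write $\mathrm{Avg}_k(a_k)=\frac1N\sum_{k=1}^N a_k$. For a density matrix $\rho$ on $\mathcal H$ let $$E_{\rm MF}(\rho)=\inf \sum_\ell p_\ell\,\mathrm{Avg}_k(s_{k,\ell}),$$ where the infimum is over all finite decompositions $\rho=\sum_\ell p_\ell|\psi_\ell\rangle\langle\psi_\ell|$ into unit vectors $\psi_\ell\in\mathcal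 H$ with probability weights $p_\ell$, and $s_{k,\ell}=-\mathrm{Tr}[\rho_{k,\ell}\ln\rho_{k,\ell}]$ is the von Neumann entropy of the reduced density matrix $\rho_{k,\ell}$ of $|\psi_\ell\rangle\langle\psi_\ell|$ on $\mathcal H_k$. Then, for every density matrix $\rho$ on $\mathcal H$: (i) for each $k$, the supremum defining $F_Q^{\max}[H_k]$ is attained, and $F_Q^{\max}[H_k]=(\lambda_{\max}^{(k)}-\lambda_{\min}^{(k)})^2$, where $\lambda_{\max}^{(k)}$ and $\lambda_{\min}^{(k)}$ are the largest and smallest eigenvalues of $H_k$; (ii) $$F_Q[\rho,H]\le \mathrm{Avg}_k\!\left(F_Q^{\max}[H_k]\right)\left(N+2N^2\sqrt{E_{\rm MF}(\rho)}\right).$$ -/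

import Mathlib

open scoped Matrix ComplexOrder

noncomputable section

namespace QInfo

/-- A density matrix on the finite-dimensional Hilbert space `ℂⁿ`: a positive semidefinite
matrix of trace one. -/
@[ext]
structure DensityMatrix (n : Type*) [Fintype n] where
  mat : Matrix n n ℂ
  posSemidef : mat.PosSemidef
  trace_eq_one : mat.trace = 1

/-- A pure state on `ℂⁿ`, given by a unit vector. -/
structure PureState (n : Type*) [Fintype n] where
  vec : EuclideanSpace ℂ n
  norm_eq_one : ‖vec‖ = 1

/-- The density matrix `|ψ⟩⟨ψ|`. -/
def PureState.toDensity {n : Type*} [Fintype n] (ψ : PureState n) : DensityMatrix n where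
  mat := Matrix.vecMulVec ψ.vec.ofLp (star ψ.vec.ofLp)
  posSemidef := Matrix.posSemidef_vecMulVec_self_star _
  trace_eq_one := by
    have h := ψ.norm_eq_one
    have h2 : inner ℂ ψ.vec ψ.vec = 1 := by
      rw [inner_self_eq_norm_sq_to_K, h]; simp
    rw [Matrix.trace_vecMulVec]
    rwa [EuclideanSpace.inner_eq_star_dotProduct] at h2

namespace DensityMatrix

section Single

variable {n : Type*} [Fintype n] [DecidableEq n]

/-- The eigenvalues of a density matrix. -/
def eig (ρ : DensityMatrix n) : n → ℝ := ρ.posSemidef.isHermitian.eigenvalues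

/-- An orthonormal basis of eigenvectors, `eigBasis i` belonging to `eig i`. -/
def eigBasis (ρ : DensityMatrix n) : OrthonormalBasis n ℂ (EuclideanSpace ℂ n) :=
  ρ.posSemidef.isHermitian.eigenvectorBasis

/-- The von Neumann entropy `-Tr[ρ ln ρ]`; here `Real.negMulLog x = -x ln x`, with value `0`
at `0`. -/
def entropy (ρ : DensityMatrix n) : ℝ := ∑ i, Real.negMulLog (ρ.eig i)

/-- The quantum Fisher information of `ρ` with respect to the Hamiltonian `H`, that is, of the
family `e^{-iθH} ρ e^{iθH}`:
`2 ∑ (λᵢ - λⱼ)² / (λᵢ + λⱼ) |⟨i|H|j⟩|²` over the pairs of eigenvectors `|i⟩`, `|j⟩` of `ρ` with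
`λᵢ + λⱼ > 0`. -/
def qfi (ρ : DensityMatrix n) (H : Matrix n n ℂ) : ℝ :=
  2 * ∑ i, ∑ j, if 0 < ρ.eig i + ρ.eig j then
    (ρ.eig i - ρ.eig j) ^ 2 / (ρ.eig i + ρ.eig j) *
      ‖inner ℂ (ρ.eigBasis i) (Matrix.toEuclideanLin H (ρ.eigBasis j))‖ ^ 2
    else 0

/-- A decomposition `ρ = ∑ p_ℓ |ψ_ℓ⟩⟨ψ_ℓ|` into finitely many pure states, with probability
weights. -/
structure PureDecomposition (ρ : DensityMatrix n) where
  m : ℕ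
  p : Fin m → ℝ
  ψ : Fin m → PureState n
  p_nonneg : ∀ l, 0 ≤ p l
  p_sum : ∑ l, p l = 1
  mat_eq : ρ.mat = ∑ l, (p l : ℂ) • (ψ l).toDensity.mat

theorem eig_nonneg (ρ : DensityMatrix n) (i : n) : 0 ≤ ρ.eig i :=
  ρ.posSemidef.eigenvalues_nonneg i

theorem sum_eig (ρ : DensityMatrix n) : ∑ i, ρ.eig i = 1 := by
  have h := ρ.posSemidef.isHermitian.trace_eq_sum_eigenvalues
  rw [ρ.trace_eq_one] at h
  have h' : ((∑ i, ρ.eig i : ℝ) : ℂ) = 1 := by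
    rw [h]; push_cast; rfl
  exact_mod_cast h'

theorem entropy_nonneg (ρ : DensityMatrix n) : 0 ≤ ρ.entropy := by
  refine Finset.sum_nonneg fun i _ => Real.negMulLog_nonneg (ρ.eig_nonneg i) ?_
  rw [← ρ.sum_eig]
  exact Finset.single_le_sum (fun j _ => ρ.eig_nonneg j) (Finset.mem_univ i)

/-- The spectral decomposition shows that pure-state decompositions exist. -/
instance (ρ : DensityMatrix n) : Nonempty ρ.PureDecomposition := by
  let e := (Fintype.equivFin n).symm
  refine ⟨⟨Fintype.card n, fun l => ρ.eig (e l),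
    fun l => ⟨ρ.eigBasis (e l), ρ.eigBasis.orthonormal.1 _⟩, fun l => ρ.eig_nonneg _, ?_, ?_⟩⟩
  · rw [e.sum_comp (fun i => ρ.eig i)]; exact ρ.sum_eig
  · have h := ρ.posSemidef.isHermitian.spectral_theorem
    ext a b
    rw [Matrix.sum_apply]
    refine Eq.trans ?_ (e.sum_comp (fun i => ((ρ.eig i : ℂ) •
      Matrix.vecMulVec (ρ.eigBasis i).ofLp (star (ρ.eigBasis i).ofLp)) a b)).symm
    conv_lhs => rw [h]
    rw [Unitary.conjStarAlgAut_apply, Matrix.mul_apply]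
    refine Finset.sum_congr rfl fun i _ => ?_
    rw [Matrix.mul_diagonal]
    simp only [Matrix.star_apply, Matrix.IsHermitian.eigenvectorUnitary_apply,
      Matrix.smul_apply, Matrix.vecMulVec_apply, Pi.star_apply, smul_eq_mul, eig, eigBasis,
      Function.comp]
    simp only [Complex.coe_algebraMap]
    ring

end Single

end DensityMatrix

/-- `F_Q^max[H]`: the supremum of the quantum Fisher information over all states. -/
def qfiMax {n : Type*} [Fintype n] [DecidableEq n] (H : Matrix n n ℂ) : ℝ :=
  ⨆ σ : DensityMatrix n, σ.qfi H

section Multi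

variable {N : ℕ} {d : Fin N → Type*}

/-- The average over the `N` subsystems. -/
def avg (f : Fin N → ℝ) : ℝ := (∑ k, f k) / N

/-- The tensor product `⨂ A_k` as a matrix on `⨂ ℂ^{d k}`, whose standard basis is indexed by
`∀ k, d k`. -/
def tensor (A : ∀ k, Matrix (d k) (d k) ℂ) : Matrix (∀ k, d k) (∀ k, d k) ℂ :=
  Matrix.of fun x y => ∏ k, A k (x k) (y k)

/-- `∑_k H_k ⊗ ⨂_{ℓ ≠ k} I_ℓ`. -/
def totalHamiltonian [∀ k, DecidableEq (d k)] (H : ∀ k, Matrix (d k) (d k) ℂ) :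
    Matrix (∀ k, d k) (∀ k, d k) ℂ :=
  ∑ k, tensor (Function.update (fun l => (1 : Matrix (d l) (d l) ℂ)) k (H k))

variable [∀ k, Fintype (d k)]

/-- The reduced density matrix on the `k`-th factor: the trace over all the other factors.
`(Equiv.piSplitAt k d).symm (a, z)` is the basis index with entry `a` at `k` and `z` elsewhere. -/
def DensityMatrix.reduced (ρ : DensityMatrix (∀ k, d k)) (k : Fin N) : DensityMatrix (d k) where
  mat := ∑ z : (∀ l : {l // l ≠ k}, d l),
    ρ.mat.submatrix (fun a => (Equiv.piSplitAt k d).symm (a, z))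
      (fun a => (Equiv.piSplitAt k d).symm (a, z))
  posSemidef := Matrix.posSemidef_sum _ fun _ _ => ρ.posSemidef.submatrix _
  trace_eq_one := by
    rw [← ρ.trace_eq_one, Matrix.trace_sum]
    simp only [Matrix.trace, Matrix.diag_apply, Matrix.submatrix_apply]
    rw [Finset.sum_comm, ← Fintype.sum_prod_type',
      (Equiv.piSplitAt k d).symm.sum_comp (fun x => ρ.mat x x)]

variable [∀ k, DecidableEq (d k)]

/-- The cost `∑_ℓ p_ℓ Avg_k (s_{k,ℓ})` of a pure-state decomposition, where `s_{k,ℓ}` is the von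
Neumann entropy of the reduced state of `ψ_ℓ` on the `k`-th factor. -/
def DensityMatrix.PureDecomposition.cost {ρ : DensityMatrix (∀ k, d k)}
    (D : ρ.PureDecomposition) : ℝ :=
  ∑ l, D.p l * avg fun k => ((D.ψ l).toDensity.reduced k).entropy

/-- The multipartite entanglement of formation `E_MF`: the infimum of the cost over all
decompositions of `ρ` into pure states. -/
def entanglementMF (ρ : DensityMatrix (∀ k, d k)) : ℝ :=
  ⨅ D : ρ.PureDecomposition, D.cost

theorem cost_nonneg {ρ : DensityMatrix (∀ k, d k)} (D : ρ.PureDecomposition) : 0 ≤ D.cost :=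
  Finset.sum_nonneg fun l _ => mul_nonneg (D.p_nonneg l)
    (div_nonneg (Finset.sum_nonneg fun _ _ => DensityMatrix.entropy_nonneg _) (Nat.cast_nonneg N))

/-- The infimum in `entanglementMF` is over a non-empty set that is bounded below. -/
theorem isGLB_entanglementMF (ρ : DensityMatrix (∀ k, d k)) :
    IsGLB (Set.range fun D : ρ.PureDecomposition => D.cost) (entanglementMF ρ) :=
  isGLB_ciInf ⟨0, by rintro _ ⟨D, rfl⟩; exact cost_nonneg D⟩

end Multi

end QInfo

end

open QInfo

/-! The quantum Fisher information is dominated by its convex roof: for any pure-state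
decomposition, `qfi` is at most the average of four times the variances. With a suitable
anti-Hermitian `Y` it equals the expectation in `ρ` of `-8HY + 4Y²`. This is linear in `ρ`, so any
decomposition may be used to evaluate it, and in each pure state completing the square bounds it by
`4‖(H - h)ψ‖²` for any real `h` (`PureDecomposition.qfi_le`). Centring a local Hamiltonian at the
midpoint of its spectrum gives the upper bound in (i); an equal superposition of extreme
eigenvectors attains it.

For (ii), the variance of the total Hamiltonian in a pure state is a sum of covariances. Diagonal
terms are at most a quarter of the squared spread. For `k ≠ l`, `covariance_le` uses two copies of
the state: the covariance is half of an inner product of differences between copies, and swapping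
the `k`-th factors reverses the sign of one difference while fixing the other. Only the part of the
doubled state not fixed by the swap contributes, and its size is governed by the purity of the
reduced state, hence by its entropy. Cauchy–Schwarz over the factors, concavity of the square root
over the decomposition, and a closure argument for the infimum finish the proof. -/

namespace QInfo

/-! ### Matrices as operators and expectations in pure states -/

section Operators

variable {n : Type*} [Fintype n] [DecidableEq n]

theorem inner_toEuclideanLin_left (M : Matrix n n ℂ) (x y : EuclideanSpace ℂ n) :
    inner ℂ (M.toEuclideanLin x) y = inner ℂ x (Mᴴ.toEuclideanLin y) := by
  rw [Matrix.toEuclideanLin_conjTranspose_eq_adjoint, LinearMap.adjoint_inner_right]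

theorem IsHermitian.inner_toEuclideanLin {M : Matrix n n ℂ} (hM : M.IsHermitian)
    (x y : EuclideanSpace ℂ n) :
    inner ℂ (M.toEuclideanLin x) y = inner ℂ x (M.toEuclideanLin y) := by
  rw [inner_toEuclideanLin_left, hM.eq]

theorem trace_vecMulVec_star_mul (v : EuclideanSpace ℂ n) (M : Matrix n n ℂ) :
    (Matrix.vecMulVec v.ofLp (star v.ofLp) * M).trace = inner ℂ v (M.toEuclideanLin v) := by
  rw [Matrix.trace_mul_comm, Matrix.mul_vecMulVec, Matrix.trace_vecMulVec,
    EuclideanSpace.inner_eq_star_dotProduct]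
  rfl

end Operators

/-! ### Variational formula and convex-roof bound for the quantum Fisher information -/

namespace DensityMatrix

variable {n : Type*} [Fintype n] [DecidableEq n]

theorem mat_eq_sum_eig (ρ : DensityMatrix n) :
    ρ.mat = ∑ i, (ρ.eig i : ℂ) •
      Matrix.vecMulVec (ρ.eigBasis i).ofLp (star (ρ.eigBasis i).ofLp) := by
  have h := ρ.posSemidef.isHermitian.spectral_theorem
  ext a b
  rw [Matrix.sum_apply]
  conv_lhs => rw [h]
  rw [Unitary.conjStarAlgAut_apply, Matrix.mul_apply]
  refine Finset.sum_congr rfl fun i _ => ?_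
  rw [Matrix.mul_diagonal]
  simp only [Matrix.star_apply, Matrix.IsHermitian.eigenvectorUnitary_apply,
    Matrix.smul_apply, Matrix.vecMulVec_apply, Pi.star_apply, smul_eq_mul, eig, eigBasis,
    Function.comp, Complex.coe_algebraMap]
  ring

theorem toEuclideanLin_eigBasis (ρ : DensityMatrix n) (i : n) :
    ρ.mat.toEuclideanLin (ρ.eigBasis i) = (ρ.eig i : ℂ) • ρ.eigBasis i := by
  rw [Matrix.toLpLin_apply]
  have := ρ.posSemidef.isHermitian.mulVec_eigenvectorBasis i
  ext a
  simpa [eigBasis, eig] using congrFun this a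

theorem trace_mul_eq_sum_eig (ρ : DensityMatrix n) (M : Matrix n n ℂ) :
    (ρ.mat * M).trace =
      ∑ i, (ρ.eig i : ℂ) * inner ℂ (ρ.eigBasis i) (M.toEuclideanLin (ρ.eigBasis i)) := by
  conv_lhs => rw [mat_eq_sum_eig, Finset.sum_mul, Matrix.trace_sum]
  simp only [Matrix.smul_mul, Matrix.trace_smul, trace_vecMulVec_star_mul, smul_eq_mul]

theorem PureDecomposition.trace_mul {ρ : DensityMatrix n} (D : ρ.PureDecomposition)
    (M : Matrix n n ℂ) :
    (ρ.mat * M).trace =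
      ∑ l, (D.p l : ℂ) * inner ℂ (D.ψ l).vec (M.toEuclideanLin (D.ψ l).vec) := by
  conv_lhs => rw [D.mat_eq, Finset.sum_mul, Matrix.trace_sum]
  simp only [Matrix.smul_mul, Matrix.trace_smul, PureState.toDensity, trace_vecMulVec_star_mul,
    smul_eq_mul]

/-- A linear functional of the state may be evaluated in any pure-state decomposition. -/
theorem PureDecomposition.sum_expectation {ρ : DensityMatrix n} (D : ρ.PureDecomposition)
    (L : EuclideanSpace ℂ n →ₗ[ℂ] EuclideanSpace ℂ n) :
    ∑ i, ρ.eig i * (inner ℂ (ρ.eigBasis i) (L (ρ.eigBasis i))).re =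
      ∑ l, D.p l * (inner ℂ (D.ψ l).vec (L (D.ψ l).vec)).re := by
  obtain ⟨M, rfl⟩ := Matrix.toEuclideanLin.surjective L
  have h := (ρ.trace_mul_eq_sum_eig M).symm.trans (D.trace_mul M)
  simpa [Complex.re_sum] using congrArg Complex.re h

/-- The off-diagonal weights of the optimal operator in the variational formula for the quantum
Fisher information. -/
noncomputable def sldCoeff (ρ : DensityMatrix n) (i j : n) : ℝ := (ρ.eig i - ρ.eig j) / (ρ.eig i + ρ.eig j)

/-- `i / 2` times the negative of the symmetric logarithmic derivative. -/
noncomputable def sldOp (ρ : DensityMatrix n) (H : Matrix n n ℂ) :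
    EuclideanSpace ℂ n →ₗ[ℂ] EuclideanSpace ℂ n :=
  Matrix.toLin ρ.eigBasis.toBasis ρ.eigBasis.toBasis
    (Matrix.of fun i j => (ρ.sldCoeff i j : ℂ) *
      inner ℂ (ρ.eigBasis i) (H.toEuclideanLin (ρ.eigBasis j)))

theorem inner_sldOp (ρ : DensityMatrix n) (H : Matrix n n ℂ) (i j : n) :
    inner ℂ (ρ.eigBasis i) (ρ.sldOp H (ρ.eigBasis j)) =
      (ρ.sldCoeff i j : ℂ) * inner ℂ (ρ.eigBasis i) (H.toEuclideanLin (ρ.eigBasis j)) := by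
  have h : ρ.sldOp H (ρ.eigBasis j) = ∑ k, ((ρ.sldCoeff k j : ℂ) *
      inner ℂ (ρ.eigBasis k) (H.toEuclideanLin (ρ.eigBasis j))) • ρ.eigBasis k := by
    have := Matrix.toLin_self ρ.eigBasis.toBasis ρ.eigBasis.toBasis
      (Matrix.of fun i j => (ρ.sldCoeff i j : ℂ) *
      inner ℂ (ρ.eigBasis i) (H.toEuclideanLin (ρ.eigBasis j))) j
    simpa [sldOp] using this
  rw [h, ρ.eigBasis.orthonormal.inner_right_fintype]

theorem sldOp_antisymm (ρ : DensityMatrix n) {H : Matrix n n ℂ} (hH : H.IsHermitian)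
    (x y : EuclideanSpace ℂ n) :
    inner ℂ (ρ.sldOp H x) y = -inner ℂ x (ρ.sldOp H y) := by
  have hA : LinearMap.adjoint (ρ.sldOp H) = -ρ.sldOp H := by
    rw [sldOp, ← Matrix.toLin_conjTranspose, ← map_neg]
    congr 1
    ext i j
    simp only [Matrix.conjTranspose_apply, Matrix.of_apply, Matrix.neg_apply, star_mul',
      RCLike.star_def, inner_conj_symm, Complex.conj_ofReal]
    rw [IsHermitian.inner_toEuclideanLin hH]
    have : ρ.sldCoeff j i = -ρ.sldCoeff i j := by
      rw [sldCoeff, sldCoeff, add_comm, ← neg_div, neg_sub]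
    rw [this]; push_cast; ring
  rw [← LinearMap.adjoint_inner_right, hA, LinearMap.neg_apply, inner_neg_right]

/-- The quantum Fisher information as an expectation in `ρ` of an operator built from `H` and
`ρ.sldOp H`. -/
theorem qfi_eq_sum_eig (ρ : DensityMatrix n) {H : Matrix n n ℂ} (hH : H.IsHermitian) :
    ρ.qfi H = ∑ j, ρ.eig j *
      (-8 * (inner ℂ (H.toEuclideanLin (ρ.eigBasis j)) (ρ.sldOp H (ρ.eigBasis j))).re
        - 4 * ‖ρ.sldOp H (ρ.eigBasis j)‖ ^ 2) := by
  set w : n → n → ℝ := fun i j =>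
    ‖inner ℂ (ρ.eigBasis i) (H.toEuclideanLin (ρ.eigBasis j))‖ ^ 2 with hw
  have hsymm : ∀ i j, w i j = w j i := fun i j => by
    simp only [hw]
    rw [← IsHermitian.inner_toEuclideanLin hH, norm_inner_symm]
  have h1 : ∀ j, (inner ℂ (H.toEuclideanLin (ρ.eigBasis j)) (ρ.sldOp H (ρ.eigBasis j))).re =
      ∑ i, ρ.sldCoeff i j * w i j := fun j => by
    rw [← ρ.eigBasis.sum_inner_mul_inner, Complex.re_sum]
    refine Finset.sum_congr rfl fun i _ => ?_
    rw [inner_sldOp, ← inner_conj_symm, mul_left_comm, ← Complex.normSq_eq_conj_mul_self,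
      Complex.normSq_eq_norm_sq, ← Complex.ofReal_mul, Complex.ofReal_re]
  have h2 : ∀ j, ‖ρ.sldOp H (ρ.eigBasis j)‖ ^ 2 = ∑ i, ρ.sldCoeff i j ^ 2 * w i j := fun j => by
    rw [← ρ.eigBasis.sum_sq_norm_inner_right]
    refine Finset.sum_congr rfl fun i _ => ?_
    rw [inner_sldOp, norm_mul, mul_pow, Complex.norm_real, Real.norm_eq_abs, sq_abs]
  -- Writing `c` for `sldCoeff i j`, which is antisymmetric, the two orderings together give `8c(λᵢ
  -- - λⱼ) - 4c²(λᵢ + λⱼ)`. If `λᵢ + λⱼ = 0`, both eigenvalues vanish and so do both sides.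
  have h3 : ∀ i j, ρ.eig j * (-8 * (ρ.sldCoeff i j * w i j) - 4 * (ρ.sldCoeff i j ^ 2 * w i j)) +
      ρ.eig i * (-8 * (ρ.sldCoeff j i * w j i) - 4 * (ρ.sldCoeff j i ^ 2 * w j i)) =
      4 * if 0 < ρ.eig i + ρ.eig j then
        (ρ.eig i - ρ.eig j) ^ 2 / (ρ.eig i + ρ.eig j) * w i j else 0 := fun i j => by
    rw [hsymm j i]
    have hi := ρ.eig_nonneg i
    have hj := ρ.eig_nonneg j
    split_ifs with h
    · rw [sldCoeff, sldCoeff, add_comm (ρ.eig j)]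
      field_simp
      ring
    · have e1 : ρ.eig i = 0 := by linarith
      have e2 : ρ.eig j = 0 := by linarith
      simp [e1, e2]
  simp only [h1, h2, Finset.mul_sum, ← Finset.sum_sub_distrib]
  -- The identity holds only after symmetrising in `i` and `j`, so the sum is doubled and one copy
  -- is transposed.
  rw [← mul_right_inj' (two_ne_zero (α := ℝ)), two_mul (∑ j, _)]
  conv_rhs => enter [2]; rw [Finset.sum_comm]
  simp only [← Finset.sum_add_distrib]
  have h4 : ∀ i j, _ := fun i j => h3 j i
  simp only [h4, qfi, Finset.mul_sum]
  rw [Finset.sum_comm]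
  refine Finset.sum_congr rfl fun i _ => Finset.sum_congr rfl fun j _ => ?_
  rw [← mul_assoc]; norm_num [hw]

/-- The quantum Fisher information is at most the average of four times the variances in any
pure-state decomposition. -/
theorem PureDecomposition.qfi_le {ρ : DensityMatrix n} (D : ρ.PureDecomposition)
    {H : Matrix n n ℂ} (hH : H.IsHermitian) (h : Fin D.m → ℝ) :
    ρ.qfi H ≤ ∑ l, D.p l *
      (4 * ‖H.toEuclideanLin (D.ψ l).vec - (h l : ℂ) • (D.ψ l).vec‖ ^ 2) := by
  set Y := ρ.sldOp H with hY
  let L : EuclideanSpace ℂ n →ₗ[ℂ] EuclideanSpace ℂ n :=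
    (-8 : ℂ) • (H.toEuclideanLin ∘ₗ Y) + (4 : ℂ) • (Y ∘ₗ Y)
  have hL : ∀ x, (inner ℂ x (L x)).re =
      -8 * (inner ℂ (H.toEuclideanLin x) (Y x)).re - 4 * ‖Y x‖ ^ 2 := fun x => by
    have e : inner ℂ x (Y (Y x)) = -((‖Y x‖ ^ 2 : ℝ) : ℂ) := by
      rw [eq_neg_iff_add_eq_zero, ← neg_eq_iff_add_eq_zero, ← ρ.sldOp_antisymm hH, ← hY,
        inner_self_eq_norm_sq_to_K]
      push_cast; rfl
    simp only [L, LinearMap.add_apply, LinearMap.smul_apply, LinearMap.comp_apply, inner_add_right,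
      inner_smul_right, e, ← IsHermitian.inner_toEuclideanLin hH]
    rw [← Complex.ofReal_neg, Complex.add_re]
    simp only [Complex.mul_re, Complex.neg_re, Complex.neg_im, Complex.re_ofNat, Complex.im_ofNat,
      Complex.ofReal_re]
    ring
  rw [qfi_eq_sum_eig ρ hH]
  simp only [← hY, ← hL]
  rw [D.sum_expectation L]
  refine Finset.sum_le_sum fun l _ => mul_le_mul_of_nonneg_left ?_ (D.p_nonneg l)
  set x := (D.ψ l).vec
  rw [hL]
  have hanti : (inner ℂ x (Y x)).re = 0 := by
    have := congrArg Complex.re (ρ.sldOp_antisymm hH x x)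
    rw [Complex.neg_re, ← inner_conj_symm, Complex.conj_re] at this
    linarith
  -- Completing the square: the cross term of `h • x` with `Y x` has zero real part because `Y` is
  -- anti-Hermitian, so the shift `h` is free.
  have h0 : 0 ≤ ‖H.toEuclideanLin x - (h l : ℂ) • x + Y x‖ ^ 2 := sq_nonneg _
  rw [@norm_add_sq ℂ, inner_sub_left, inner_smul_left] at h0
  simp only [RCLike.re_to_complex, Complex.sub_re, Complex.conj_ofReal, Complex.re_ofReal_mul,
    hanti] at h0
  linarith

end DensityMatrix
-- Operator norm of a Hermitian matrix centred on its spectrum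
section Spread

variable {n : Type*} [Fintype n] [DecidableEq n]

/-- The identity `CᴴC + GᴴG = c²` is an algebraic certificate for the operator norm bound. It
survives tensoring with identities, so bounds pass to embedded and doubled operators without
computing their spectra. -/
theorem norm_toEuclideanLin_le {C G : Matrix n n ℂ} {c : ℝ} (hc : 0 ≤ c)
    (h : Cᴴ * C + Gᴴ * G = ((c ^ 2 : ℝ) : ℂ) • 1) (x : EuclideanSpace ℂ n) :
    ‖C.toEuclideanLin x‖ ≤ c * ‖x‖ := by
  have key : ∀ M : Matrix n n ℂ,
      inner ℂ x ((Mᴴ * M).toEuclideanLin x) = ((‖M.toEuclideanLin x‖ ^ 2 : ℝ) : ℂ) := fun M => by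
    rw [Matrix.toLpLin_mul_same, LinearMap.comp_apply, ← inner_toEuclideanLin_left,
      inner_self_eq_norm_sq_to_K]
    push_cast; rfl
  have h1 : inner ℂ x ((Cᴴ * C + Gᴴ * G).toEuclideanLin x) =
      ((c ^ 2 * ‖x‖ ^ 2 : ℝ) : ℂ) := by
    rw [h, map_smul, LinearMap.smul_apply, Matrix.toLpLin_one, LinearMap.id_apply, inner_smul_right,
      inner_self_eq_norm_sq_to_K]
    push_cast; rfl
  rw [map_add, LinearMap.add_apply, inner_add_right, key, key] at h1
  have h2 : ‖C.toEuclideanLin x‖ ^ 2 + ‖G.toEuclideanLin x‖ ^ 2 = c ^ 2 * ‖x‖ ^ 2 := by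
    exact_mod_cast h1
  refine abs_le_of_sq_le_sq' ?_ (by positivity) |>.2
  rw [mul_pow]
  nlinarith [sq_nonneg ‖G.toEuclideanLin x‖]

/-- The difference of the largest and the smallest eigenvalue. -/
noncomputable def spread {H : Matrix n n ℂ} (hH : H.IsHermitian) : ℝ :=
  (⨆ i, hH.eigenvalues i) - ⨅ i, hH.eigenvalues i

/-- The midpoint of the spectrum. -/
noncomputable def midpt {H : Matrix n n ℂ} (hH : H.IsHermitian) : ℝ :=
  ((⨆ i, hH.eigenvalues i) + ⨅ i, hH.eigenvalues i) / 2

/-- The operator shifted so that its spectrum is centred at zero. -/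
noncomputable def centred {H : Matrix n n ℂ} (hH : H.IsHermitian) : Matrix n n ℂ :=
  H - (midpt hH : ℂ) • 1

theorem centred_isHermitian {H : Matrix n n ℂ} (hH : H.IsHermitian) :
    (centred hH).IsHermitian := by
  refine hH.sub ?_
  rw [Matrix.IsHermitian, Matrix.conjTranspose_smul, Matrix.conjTranspose_one]
  simp

theorem centred_apply {H : Matrix n n ℂ} (hH : H.IsHermitian) (x : EuclideanSpace ℂ n) :
    (centred hH).toEuclideanLin x = H.toEuclideanLin x - (midpt hH : ℂ) • x := by
  rw [centred, map_sub, map_smul, Matrix.toLpLin_one]; rfl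

theorem spread_nonneg [Nonempty n] {H : Matrix n n ℂ} (hH : H.IsHermitian) : 0 ≤ spread hH :=
  sub_nonneg.2 (ciInf_le_ciSup (Set.finite_range _).bddBelow (Set.finite_range _).bddAbove)

/-- In the eigenbasis, `G` has entries `√((a - λ)(λ - b))` with `a` and `b` the extreme eigenvalues,
and `(λ - (a + b)/2)² + (a - λ)(λ - b) = ((a - b)/2)²`. -/
theorem exists_centred_sq_add {H : Matrix n n ℂ} (hH : H.IsHermitian) :
    ∃ G : Matrix n n ℂ, (centred hH)ᴴ * centred hH + Gᴴ * G =
      (((spread hH / 2) ^ 2 : ℝ) : ℂ) • 1 := by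
  set a := ⨆ i, hH.eigenvalues i with ha
  set b := ⨅ i, hH.eigenvalues i with hb
  have h1 : ∀ i, hH.eigenvalues i ≤ a := le_ciSup (Set.finite_range _).bddAbove
  have h2 : ∀ i, b ≤ hH.eigenvalues i := ciInf_le (Set.finite_range _).bddBelow
  let φ := Unitary.conjStarAlgAut ℂ (Matrix n n ℂ) hH.eigenvectorUnitary
  let g : n → ℝ := fun i => √((a - hH.eigenvalues i) * (hH.eigenvalues i - b))
  have hC : centred hH =
      φ (Matrix.diagonal fun i => ((hH.eigenvalues i - midpt hH : ℝ) : ℂ)) := by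
    have : (Matrix.diagonal fun i => ((hH.eigenvalues i - midpt hH : ℝ) : ℂ)) =
        Matrix.diagonal (RCLike.ofReal ∘ hH.eigenvalues) - (midpt hH : ℂ) • 1 := by
      rw [Matrix.smul_one_eq_diagonal, Matrix.diagonal_sub]
      congr 1; ext i; simp
    rw [this, map_sub, map_smul, map_one, ← hH.spectral_theorem, centred]
  refine ⟨φ (Matrix.diagonal fun i => (g i : ℂ)), ?_⟩
  rw [hC]
  simp only [← Matrix.star_eq_conjTranspose, ← map_star, ← map_mul, ← map_add]
  have : (((spread hH / 2) ^ 2 : ℝ) : ℂ) • (1 : Matrix n n ℂ) =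
      φ ((((spread hH / 2) ^ 2 : ℝ) : ℂ) • (1 : Matrix n n ℂ)) := by
    rw [map_smul, map_one]
  rw [this]
  congr 1
  simp only [Matrix.star_eq_conjTranspose, Matrix.diagonal_conjTranspose,
    Matrix.diagonal_mul_diagonal, Matrix.diagonal_add, Matrix.smul_one_eq_diagonal]
  congr 1
  ext i
  have hg : g i * g i = (a - hH.eigenvalues i) * (hH.eigenvalues i - b) :=
    Real.mul_self_sqrt (mul_nonneg (sub_nonneg.2 (h1 i)) (sub_nonneg.2 (h2 i)))
  simp only [Pi.star_apply, RCLike.star_def, Complex.conj_ofReal, ← Complex.ofReal_mul,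
    ← Complex.ofReal_add, hg]
  rw [spread, midpt, ← ha, ← hb]
  congr 1
  ring

theorem norm_centred_le [Nonempty n] {H : Matrix n n ℂ} (hH : H.IsHermitian)
    (x : EuclideanSpace ℂ n) : ‖(centred hH).toEuclideanLin x‖ ≤ spread hH / 2 * ‖x‖ := by
  obtain ⟨G, hG⟩ := exists_centred_sq_add hH
  exact norm_toEuclideanLin_le (by have := spread_nonneg hH; positivity) hG x

end Spread

/-! ### The maximal quantum Fisher information -/

namespace DensityMatrix

variable {n : Type*} [Fintype n] [DecidableEq n]

theorem nonempty {n : Type*} [Fintype n] (ρ : DensityMatrix n) : Nonempty n := by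
  by_contra h
  rw [not_nonempty_iff] at h
  simpa [Matrix.trace] using ρ.trace_eq_one

theorem qfi_nonneg (ρ : DensityMatrix n) (H : Matrix n n ℂ) : 0 ≤ ρ.qfi H := by
  refine mul_nonneg zero_le_two (Finset.sum_nonneg fun i _ => Finset.sum_nonneg fun j _ => ?_)
  split_ifs <;> positivity

/-- The convex-roof bound is applied with every vector shifted by the midpoint of the spectrum,
where `‖(H - h)ψ‖` is at most half the spread. -/
theorem qfi_le_spread_sq (ρ : DensityMatrix n) {H : Matrix n n ℂ} (hH : H.IsHermitian) :
    ρ.qfi H ≤ spread hH ^ 2 := by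
  have := ρ.nonempty
  obtain ⟨D⟩ : Nonempty ρ.PureDecomposition := inferInstance
  refine (D.qfi_le hH fun _ => midpt hH).trans ?_
  calc _ ≤ ∑ l, D.p l * spread hH ^ 2 := Finset.sum_le_sum fun l _ =>
        mul_le_mul_of_nonneg_left ?_ (D.p_nonneg l)
    _ = _ := by rw [← Finset.sum_mul, D.p_sum, one_mul]
  have h := norm_centred_le hH (D.ψ l).vec
  rw [centred_apply, (D.ψ l).norm_eq_one, mul_one] at h
  have := pow_le_pow_left₀ (norm_nonneg _) h 2
  linarith

/-- The quantum Fisher information dominates twice the squared Hilbert–Schmidt norm of the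
commutator `[ρ, H]`. -/
theorem sum_norm_commutator_sq_le_qfi (ρ : DensityMatrix n) (H : Matrix n n ℂ) :
    2 * ∑ j, ‖(ρ.mat * H - H * ρ.mat).toEuclideanLin (ρ.eigBasis j)‖ ^ 2 ≤ ρ.qfi H := by
  refine mul_le_mul_of_nonneg_left ?_ zero_le_two
  rw [Finset.sum_comm]
  refine Finset.sum_le_sum fun j _ => ?_
  rw [← ρ.eigBasis.sum_sq_norm_inner_right]
  refine Finset.sum_le_sum fun i _ => ?_
  have h1 : inner ℂ (ρ.eigBasis i) ((ρ.mat * H - H * ρ.mat).toEuclideanLin (ρ.eigBasis j)) =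
      ((ρ.eig i - ρ.eig j : ℝ) : ℂ) *
        inner ℂ (ρ.eigBasis i) (H.toEuclideanLin (ρ.eigBasis j)) := by
    rw [map_sub, LinearMap.sub_apply, Matrix.toLpLin_mul_same, Matrix.toLpLin_mul_same,
      LinearMap.comp_apply, LinearMap.comp_apply, inner_sub_right,
      ← IsHermitian.inner_toEuclideanLin ρ.posSemidef.isHermitian, toEuclideanLin_eigBasis,
      toEuclideanLin_eigBasis, map_smul, inner_smul_left, inner_smul_right, Complex.conj_ofReal]
    push_cast; ring
  rw [h1, norm_mul, mul_pow, Complex.norm_real, Real.norm_eq_abs, sq_abs]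
  have hi := ρ.eig_nonneg i
  have hj := ρ.eig_nonneg j
  split_ifs with h
  · refine mul_le_mul_of_nonneg_right ?_ (sq_nonneg _)
    rw [le_div_iff₀ h]
    -- Two distinct eigenvalues sum to at most 1, so dividing by the sum only increases the term.
    -- For `i = j` the sum may exceed 1, but the numerator vanishes.
    by_cases hij : i = j
    · simp [hij]
    · refine mul_le_of_le_one_right (sq_nonneg _) ?_
      rw [← ρ.sum_eig, ← Finset.sum_pair hij]
      exact Finset.sum_le_sum_of_subset_of_nonneg (Finset.subset_univ _)
        fun k _ _ => ρ.eig_nonneg k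
  · have : ρ.eig i - ρ.eig j = 0 := by linarith
    simp [this]

/-- The Hilbert–Schmidt norm of the commutator does not depend on the basis, so the eigenbasis
chosen for `|ψ⟩⟨ψ|` need not be known. The commutator is `r(|ψ⟩⟨u| - |u⟩⟨ψ|)`, of squared norm
`2r²`. -/
theorem qfi_pure_ge {H : Matrix n n ℂ} (hH : H.IsHermitian) (ψ : PureState n)
    {u : EuclideanSpace ℂ n} (hu : ‖u‖ = 1) (huv : inner ℂ ψ.vec u = 0) {m r : ℝ}
    (h : H.toEuclideanLin ψ.vec = (m : ℂ) • ψ.vec + (r : ℂ) • u) :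
    4 * r ^ 2 ≤ ψ.toDensity.qfi H := by
  refine le_trans (le_of_eq ?_) (sum_norm_commutator_sq_le_qfi _ _)
  have hρ : ∀ x, ψ.toDensity.mat.toEuclideanLin x = inner ℂ ψ.vec x • ψ.vec := fun x => by
    rw [Matrix.toLpLin_apply, PureState.toDensity]
    ext a
    simp [Matrix.vecMulVec_mulVec, EuclideanSpace.inner_eq_star_dotProduct, dotProduct_comm,
      mul_comm]
  have hK : ∀ x, ‖(ψ.toDensity.mat * H - H * ψ.toDensity.mat).toEuclideanLin x‖ ^ 2 =
      r ^ 2 * (‖inner ℂ u x‖ ^ 2 + ‖inner ℂ ψ.vec x‖ ^ 2) := fun x => by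
    have e : (ψ.toDensity.mat * H - H * ψ.toDensity.mat).toEuclideanLin x =
        (r : ℂ) • (inner ℂ u x • ψ.vec - inner ℂ ψ.vec x • u) := by
      rw [map_sub, LinearMap.sub_apply, Matrix.toLpLin_mul_same, Matrix.toLpLin_mul_same,
        LinearMap.comp_apply, LinearMap.comp_apply, hρ, hρ,
        ← IsHermitian.inner_toEuclideanLin hH, map_smul, h, inner_add_left, inner_smul_left,
        inner_smul_left, Complex.conj_ofReal, Complex.conj_ofReal]
      module
    rw [e, norm_smul, mul_pow, Complex.norm_real, Real.norm_eq_abs, sq_abs, @norm_sub_sq ℂ,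
      norm_smul, norm_smul, hu, ψ.norm_eq_one, inner_smul_left, inner_smul_right, huv]
    simp
  simp only [hK]
  rw [← Finset.mul_sum, Finset.sum_add_distrib, OrthonormalBasis.sum_sq_norm_inner_left,
    OrthonormalBasis.sum_sq_norm_inner_left, hu, ψ.norm_eq_one]
  ring

theorem exists_spread_sq_le_qfi [Nonempty n] {H : Matrix n n ℂ} (hH : H.IsHermitian) :
    ∃ σ : DensityMatrix n, spread hH ^ 2 ≤ σ.qfi H := by
  obtain ⟨i, hi⟩ := exists_eq_ciSup_of_finite (f := hH.eigenvalues)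
  obtain ⟨j, hj⟩ := exists_eq_ciInf_of_finite (f := hH.eigenvalues)
  set e := hH.eigenvectorBasis
  have he : ∀ k, H.toEuclideanLin (e k) = (hH.eigenvalues k : ℂ) • e k := fun k => by
    rw [Matrix.toLpLin_apply]
    have := hH.mulVec_eigenvectorBasis k
    ext a
    simpa using congrFun this a
  -- If the same index attains both extremes, the spread is zero and any state will do.
  by_cases hij : i = j
  · refine ⟨(PureState.mk (e i) (e.orthonormal.1 i)).toDensity, ?_⟩
    rw [spread, ← hi, ← hj, hij, sub_self, zero_pow two_ne_zero]
    exact qfi_nonneg _ _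
  have hs : ((√2)⁻¹ : ℝ) ^ 2 = 1 / 2 := by rw [inv_pow, Real.sq_sqrt zero_le_two, one_div]
  have hii : inner ℂ (e i) (e j) = 0 := e.orthonormal.2 hij
  have hjj : inner ℂ (e j) (e i) = 0 := e.orthonormal.2 (Ne.symm hij)
  have hv : ‖((√2)⁻¹ : ℝ) • (e i + e j)‖ = 1 := by
    rw [← sq_eq_sq₀ (norm_nonneg _) zero_le_one, norm_smul, mul_pow, Real.norm_eq_abs, sq_abs, hs,
      @norm_add_sq ℂ, hii, e.orthonormal.1, e.orthonormal.1]
    norm_num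
  have hu : ‖((√2)⁻¹ : ℝ) • (e i - e j)‖ = 1 := by
    rw [← sq_eq_sq₀ (norm_nonneg _) zero_le_one, norm_smul, mul_pow, Real.norm_eq_abs, sq_abs, hs,
      @norm_sub_sq ℂ, hii, e.orthonormal.1, e.orthonormal.1]
    norm_num
  refine ⟨(PureState.mk _ hv).toDensity, ?_⟩
  -- `H` sends the normalised sum of the extreme eigenvectors to the midpoint times itself plus half
  -- the spread times the normalised difference.
  have hfin := qfi_pure_ge hH (PureState.mk _ hv) (u := ((√2)⁻¹ : ℝ) • (e i - e j))
    (m := midpt hH) (r := spread hH / 2) hu ?_ ?_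
  · linarith
  · change inner ℂ (((√2)⁻¹ : ℝ) • (e i + e j)) (((√2)⁻¹ : ℝ) • (e i - e j)) = 0
    rw [← Complex.coe_smul, ← Complex.coe_smul, inner_smul_left, inner_smul_right, inner_sub_right,
      inner_add_left, inner_add_left, hii, hjj, inner_self_eq_norm_sq_to_K,
      inner_self_eq_norm_sq_to_K, e.orthonormal.1, e.orthonormal.1]
    simp
  · have ha : hH.eigenvalues i = midpt hH + spread hH / 2 := by
      rw [spread, midpt, ← hi]; ring
    have hb : hH.eigenvalues j = midpt hH - spread hH / 2 := by
      rw [spread, midpt, ← hj]; ring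
    simp only [← Complex.coe_smul, map_smul, map_add, he, ha, hb]
    push_cast
    module

theorem isGreatest_qfi [Nonempty n] {H : Matrix n n ℂ} (hH : H.IsHermitian) :
    IsGreatest (Set.range fun σ : DensityMatrix n => σ.qfi H) (spread hH ^ 2) := by
  obtain ⟨σ, hσ⟩ := exists_spread_sq_le_qfi hH
  refine ⟨⟨σ, (σ.qfi_le_spread_sq hH).antisymm hσ⟩, ?_⟩
  rintro _ ⟨τ, rfl⟩
  exact τ.qfi_le_spread_sq hH

theorem qfiMax_eq [Nonempty n] {H : Matrix n n ℂ} (hH : H.IsHermitian) :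
    qfiMax H = spread hH ^ 2 :=
  (isGreatest_qfi hH).csSup_eq

end DensityMatrix
-- Local operators on a tensor product
section Embed

variable {N : ℕ} {d : Fin N → Type*}

theorem tensor_mul [∀ k, Fintype (d k)] (A B : ∀ k, Matrix (d k) (d k) ℂ) :
    tensor A * tensor B = tensor fun k => A k * B k := by
  ext x y
  simp only [tensor, Matrix.mul_apply, Matrix.of_apply, ← Finset.prod_mul_distrib]
  rw [Fintype.prod_sum]

theorem tensor_conjTranspose (A : ∀ k, Matrix (d k) (d k) ℂ) :
    (tensor A)ᴴ = tensor fun k => (A k)ᴴ := by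
  ext x y
  simp [tensor, Matrix.conjTranspose_apply]

variable [∀ k, DecidableEq (d k)]

theorem tensor_one : tensor (fun k => (1 : Matrix (d k) (d k) ℂ)) = 1 := by
  ext x y
  simp only [tensor, Matrix.of_apply, Matrix.one_apply]
  by_cases h : x = y
  · simp [h]
  · rw [if_neg h]
    obtain ⟨k, hk⟩ := Function.ne_iff.1 h
    exact Finset.prod_eq_zero (Finset.mem_univ k) (if_neg hk)

/-- The operator acting as `A` on the `k`-th factor and trivially on the others. -/
noncomputable def embed (k : Fin N) (A : Matrix (d k) (d k) ℂ) :
    Matrix (∀ k, d k) (∀ k, d k) ℂ :=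
  tensor (Function.update (fun l => (1 : Matrix (d l) (d l) ℂ)) k A)

theorem embed_apply (k : Fin N) (A : Matrix (d k) (d k) ℂ) (x y : ∀ k, d k) :
    embed k A x y = A (x k) (y k) *
      ∏ l ∈ Finset.univ.erase k, (1 : Matrix (d l) (d l) ℂ) (x l) (y l) := by
  rw [embed, tensor, Matrix.of_apply, ← Finset.mul_prod_erase _ _ (Finset.mem_univ k),
    Function.update_self]
  congr 1
  refine Finset.prod_congr rfl fun l hl => ?_
  rw [Function.update_of_ne (Finset.ne_of_mem_erase hl)]

theorem embed_add (k : Fin N) (A B : Matrix (d k) (d k) ℂ) :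
    embed k (A + B) = embed k A + embed k B := by
  ext x y
  simp only [embed_apply, Matrix.add_apply, add_mul]

theorem embed_smul (k : Fin N) (c : ℂ) (A : Matrix (d k) (d k) ℂ) :
    embed k (c • A) = c • embed k A := by
  ext x y
  simp only [embed_apply, Matrix.smul_apply, smul_eq_mul, mul_assoc]

theorem embed_one (k : Fin N) : embed k (1 : Matrix (d k) (d k) ℂ) = 1 := by
  rw [embed, Function.update_eq_self_iff.2 rfl, tensor_one]

theorem embed_conjTranspose (k : Fin N) (A : Matrix (d k) (d k) ℂ) :
    (embed k A)ᴴ = embed k Aᴴ := by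
  rw [embed, embed, tensor_conjTranspose]
  congr 1
  ext1 l
  by_cases h : l = k
  · subst h; simp
  · simp [Function.update_of_ne h]

theorem embed_isHermitian (k : Fin N) {A : Matrix (d k) (d k) ℂ} (hA : A.IsHermitian) :
    (embed k A).IsHermitian := by
  rw [Matrix.IsHermitian, embed_conjTranspose, hA.eq]

variable [∀ k, Fintype (d k)]

theorem embed_mul (k : Fin N) (A B : Matrix (d k) (d k) ℂ) :
    embed k A * embed k B = embed k (A * B) := by
  rw [embed, embed, embed, tensor_mul]
  congr 1
  ext1 l
  by_cases h : l = k
  · subst h; simp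
  · simp [Function.update_of_ne h]

theorem embed_comm {k l : Fin N} (hkl : k ≠ l) (A : Matrix (d k) (d k) ℂ)
    (B : Matrix (d l) (d l) ℂ) : embed k A * embed l B = embed l B * embed k A := by
  rw [embed, embed, tensor_mul, tensor_mul]
  congr 1
  ext1 j
  by_cases h : j = k
  · subst h; simp [Function.update_of_ne hkl]
  · simp [Function.update_of_ne h]

theorem norm_embed_le {k : Fin N} {C G : Matrix (d k) (d k) ℂ} {c : ℝ} (hc : 0 ≤ c)
    (h : Cᴴ * C + Gᴴ * G = ((c ^ 2 : ℝ) : ℂ) • 1) (x : EuclideanSpace ℂ (∀ k, d k)) :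
    ‖(embed k C).toEuclideanLin x‖ ≤ c * ‖x‖ := by
  refine norm_toEuclideanLin_le (G := embed k G) hc ?_ x
  rw [embed_conjTranspose, embed_conjTranspose, embed_mul, embed_mul, ← embed_add, h, embed_smul,
    embed_one]

end Embed

/-! ### Covariances from two copies of a state -/

section TwoCopies

open scoped Kronecker

/-- The two-copy vector `v ⊗ w`. -/
noncomputable def tens {X : Type*} (v w : EuclideanSpace ℂ X) : EuclideanSpace ℂ (X × X) :=
  WithLp.toLp 2 fun p => v p.1 * w p.2

theorem inner_tens {X : Type*} [Fintype X] (v w v' w' : EuclideanSpace ℂ X) :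
    inner ℂ (tens v w) (tens v' w') = inner ℂ v v' * inner ℂ w w' := by
  simp only [PiLp.inner_apply, tens, Fintype.sum_prod_type, Finset.sum_mul_sum,
    RCLike.inner_apply, map_mul]
  refine Finset.sum_congr rfl fun i _ => Finset.sum_congr rfl fun j _ => ?_
  ring

/-- The difference of the operators `A` on the first and on the second copy. -/
noncomputable def copyDiff {X : Type*} [DecidableEq X] (A : Matrix X X ℂ) : Matrix (X × X) (X × X) ℂ := A ⊗ₖ 1 - 1 ⊗ₖ A

theorem copyDiff_isHermitian {X : Type*} [DecidableEq X] {A : Matrix X X ℂ} (hA : A.IsHermitian) :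
    (copyDiff A).IsHermitian := by
  rw [Matrix.IsHermitian, copyDiff, Matrix.conjTranspose_sub, Matrix.conjTranspose_kronecker,
    Matrix.conjTranspose_kronecker, hA.eq, Matrix.conjTranspose_one]

variable {X : Type*} [Fintype X] [DecidableEq X]

theorem kronecker_tens (A B : Matrix X X ℂ) (v w : EuclideanSpace ℂ X) :
    (A ⊗ₖ B).toEuclideanLin (tens v w) = tens (A.toEuclideanLin v) (B.toEuclideanLin w) := by
  ext p
  simp only [Matrix.toLpLin_apply, tens, Matrix.mulVec, dotProduct, Fintype.sum_prod_type,
    Finset.sum_mul_sum, Matrix.kroneckerMap_apply]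
  refine Finset.sum_congr rfl fun i _ => Finset.sum_congr rfl fun j _ => ?_
  ring

theorem copyDiff_comm {A B : Matrix X X ℂ} (h : A * B = B * A) :
    copyDiff A * copyDiff B = copyDiff B * copyDiff A := by
  simp only [copyDiff, sub_mul, mul_sub, ← Matrix.mul_kronecker_mul, h, one_mul, mul_one]
  abel

theorem copyDiff_tens (A : Matrix X X ℂ) (v : EuclideanSpace ℂ X) :
    (copyDiff A).toEuclideanLin (tens v v) =
      tens (A.toEuclideanLin v) v - tens v (A.toEuclideanLin v) := by
  rw [copyDiff, map_sub, LinearMap.sub_apply, kronecker_tens, kronecker_tens, Matrix.toLpLin_one,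
    LinearMap.id_apply]

theorem norm_copyDiff_le {C G : Matrix X X ℂ} {c : ℝ} (hc : 0 ≤ c)
    (h : Cᴴ * C + Gᴴ * G = ((c ^ 2 : ℝ) : ℂ) • 1) (x : EuclideanSpace ℂ (X × X)) :
    ‖(copyDiff C).toEuclideanLin x‖ ≤ 2 * c * ‖x‖ := by
  have h1 : ‖(C ⊗ₖ (1 : Matrix X X ℂ)).toEuclideanLin x‖ ≤ c * ‖x‖ := by
    refine norm_toEuclideanLin_le (G := G ⊗ₖ (1 : Matrix X X ℂ)) hc ?_ x
    rw [Matrix.conjTranspose_kronecker, Matrix.conjTranspose_kronecker, ← Matrix.mul_kronecker_mul,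
      ← Matrix.mul_kronecker_mul, ← Matrix.add_kronecker, h, Matrix.conjTranspose_one, one_mul,
      Matrix.smul_kronecker, Matrix.one_kronecker_one]
  have h2 : ‖((1 : Matrix X X ℂ) ⊗ₖ C).toEuclideanLin x‖ ≤ c * ‖x‖ := by
    refine norm_toEuclideanLin_le (G := (1 : Matrix X X ℂ) ⊗ₖ G) hc ?_ x
    rw [Matrix.conjTranspose_kronecker, Matrix.conjTranspose_kronecker, ← Matrix.mul_kronecker_mul,
      ← Matrix.mul_kronecker_mul, Matrix.conjTranspose_one, one_mul, ← Matrix.kronecker_add, h,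
      Matrix.kronecker_smul, Matrix.one_kronecker_one]
  rw [copyDiff, map_sub, LinearMap.sub_apply]
  linarith [norm_sub_le ((C ⊗ₖ (1 : Matrix X X ℂ)).toEuclideanLin x)
    (((1 : Matrix X X ℂ) ⊗ₖ C).toEuclideanLin x)]

theorem copyDiff_inner_tens_self {A B : Matrix X X ℂ} (hA : A.IsHermitian) (hB : B.IsHermitian)
    {v : EuclideanSpace ℂ X} (hv : ‖v‖ = 1) :
    (inner ℂ ((copyDiff A).toEuclideanLin (tens v v))
      ((copyDiff B).toEuclideanLin (tens v v))).re =
    2 * ((inner ℂ (A.toEuclideanLin v) (B.toEuclideanLin v)).re -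
      (inner ℂ v (A.toEuclideanLin v)).re * (inner ℂ v (B.toEuclideanLin v)).re) := by
  have him : ∀ {M : Matrix X X ℂ}, M.IsHermitian →
      inner ℂ v (M.toEuclideanLin v) = ((inner ℂ v (M.toEuclideanLin v)).re : ℂ) := fun hM => by
    refine (Complex.conj_eq_iff_re.1 ?_).symm
    rw [inner_conj_symm, IsHermitian.inner_toEuclideanLin hM]
  have hvv : inner ℂ v v = 1 := by
    rw [inner_self_eq_norm_sq_to_K, hv]; simp
  rw [copyDiff_tens, copyDiff_tens]
  simp only [inner_sub_left, inner_sub_right, inner_tens, hvv, one_mul, mul_one,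
    IsHermitian.inner_toEuclideanLin hA v v]
  have hBv : inner ℂ (B.toEuclideanLin v) v = inner ℂ v (B.toEuclideanLin v) :=
    IsHermitian.inner_toEuclideanLin hB v v
  rw [him hA, him hB, ← Complex.ofReal_mul]
  simp only [Complex.sub_re, Complex.ofReal_re, ← Complex.ofReal_mul]
  ring

/-- The relations make `ABF` anti-Hermitian: its adjoint is `FBA = FAB = -ABF`. Its expectation is
therefore imaginary, and subtracting `F x` leaves the real part unchanged. -/
theorem re_inner_anticomm {V : Type*} [NormedAddCommGroup V] [InnerProductSpace ℂ V]
    {A B F : V →ₗ[ℂ] V} (hA : A.IsSymmetric) (hB : B.IsSymmetric) (hF : F.IsSymmetric)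
    (hAB : ∀ x, A (B x) = B (A x)) (hAF : ∀ x, A (F x) = -F (A x)) (hBF : ∀ x, B (F x) = F (B x))
    (x : V) : (inner ℂ (A x) (B (x - F x))).re = (inner ℂ (A x) (B x)).re := by
  have h : inner ℂ (A x) (B (F x)) = -inner ℂ (B (F x)) (A x) := by
    calc inner ℂ (A x) (B (F x)) = inner ℂ (F (A x)) (B x) := by rw [hBF, hF]
      _ = -inner ℂ (F x) (A (B x)) := by rw [← hA, hAF, inner_neg_left, neg_neg]
      _ = _ := by rw [hAB, hB]
  have h2 := congrArg Complex.re h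
  rw [Complex.neg_re, ← inner_conj_symm (A x), Complex.conj_re] at h2
  have h3 : (inner ℂ (A x) (B (F x))).re = 0 := by
    rw [← inner_conj_symm, Complex.conj_re]; linarith
  rw [map_sub, inner_sub_right, Complex.sub_re, h3, sub_zero]

end TwoCopies

/-! ### The swap of one tensor factor between two copies -/

section Swap

open scoped Kronecker

variable {N : ℕ} {d : Fin N → Type*}

/-- Exchange the `k`-th entries of two basis indices. -/
def swapAt (k : Fin N) : (∀ k, d k) × (∀ k, d k) ≃ (∀ k, d k) × (∀ k, d k) :=
  Function.Involutive.toPerm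
    (fun p => (Function.update p.1 k (p.2 k), Function.update p.2 k (p.1 k)))
    (fun p => by simp)

theorem swapAt_apply (k : Fin N) (p : (∀ k, d k) × (∀ k, d k)) :
    swapAt k p = (Function.update p.1 k (p.2 k), Function.update p.2 k (p.1 k)) := rfl

theorem tensor_kronecker_submatrix_swapAt (k : Fin N) (A B : ∀ k, Matrix (d k) (d k) ℂ) :
    (tensor A ⊗ₖ tensor B).submatrix (swapAt k) (swapAt k) =
      tensor (Function.update A k (B k)) ⊗ₖ tensor (Function.update B k (A k)) := by
  ext p q
  simp only [Matrix.submatrix_apply, Matrix.kroneckerMap_apply, tensor, Matrix.of_apply,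
    swapAt_apply, ← Finset.prod_mul_distrib]
  refine Finset.prod_congr rfl fun j _ => ?_
  by_cases h : j = k
  · subst h; simp [mul_comm]
  · simp [Function.update_of_ne h]

theorem splitAt_swapAt (k : Fin N) (a b : d k) (z w : ∀ l : {l // l ≠ k}, d l) :
    swapAt k ((Equiv.piSplitAt k d).symm (a, z), (Equiv.piSplitAt k d).symm (b, w)) =
      ((Equiv.piSplitAt k d).symm (b, z), (Equiv.piSplitAt k d).symm (a, w)) := by
  rw [swapAt_apply]
  ext j
  all_goals
    by_cases h : j = k
    · subst h; simp
    · simp [h]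

section

variable [∀ k, Fintype (d k)]

/-- The unitary exchanging the `k`-th factors of the two copies. -/
noncomputable def swapOp (k : Fin N) :
    EuclideanSpace ℂ ((∀ k, d k) × (∀ k, d k)) ≃ₗᵢ[ℂ] EuclideanSpace ℂ ((∀ k, d k) × (∀ k, d k)) :=
  LinearIsometryEquiv.piLpCongrLeft 2 ℂ ℂ (swapAt k)

theorem swapOp_apply (k : Fin N) (v : EuclideanSpace ℂ ((∀ k, d k) × (∀ k, d k)))
    (p : (∀ k, d k) × (∀ k, d k)) : swapOp k v p = v (swapAt k p) := rfl

theorem swapOp_swapOp (k : Fin N) (v : EuclideanSpace ℂ ((∀ k, d k) × (∀ k, d k))) :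
    swapOp k (swapOp k v) = v := by
  ext p
  exact congrArg v ((swapAt k).symm_apply_apply p)

theorem swapOp_isSymmetric (k : Fin N) :
    (swapOp (d := d) k).toLinearEquiv.toLinearMap.IsSymmetric := fun x y => by
  change inner ℂ (swapOp k x) y = inner ℂ x (swapOp k y)
  rw [← (swapOp k).inner_map_map, swapOp_swapOp]

/-- The purity of the reduced state is the expectation of the swap on two copies. -/
theorem inner_swapOp_tens (ψ : PureState (∀ k, d k)) (k : Fin N) :
    inner ℂ (tens ψ.vec ψ.vec) (swapOp k (tens ψ.vec ψ.vec)) =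
      ((ψ.toDensity.reduced k).mat * (ψ.toDensity.reduced k).mat).trace := by
  have h1 : ∀ a b, (ψ.toDensity.reduced k).mat a b = ∑ z,
      ψ.vec ((Equiv.piSplitAt k d).symm (a, z)) *
        star (ψ.vec ((Equiv.piSplitAt k d).symm (b, z))) := fun a b => by
    simp [DensityMatrix.reduced, Matrix.sum_apply, PureState.toDensity, Matrix.vecMulVec_apply]
  simp only [Matrix.trace, Matrix.diag_apply, Matrix.mul_apply, h1, Finset.sum_mul_sum]
  rw [PiLp.inner_apply, Fintype.sum_prod_type,
    ← (Equiv.piSplitAt k d).symm.sum_comp, Fintype.sum_prod_type]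
  conv_lhs => enter [2, a, 2, z]; rw [← (Equiv.piSplitAt k d).symm.sum_comp, Fintype.sum_prod_type]
  refine Finset.sum_congr rfl fun a _ => ?_
  rw [Finset.sum_comm]
  refine Finset.sum_congr rfl fun b _ => ?_
  rw [Finset.sum_comm]
  refine Finset.sum_congr rfl fun w _ => Finset.sum_congr rfl fun z _ => ?_
  rw [swapOp_apply, splitAt_swapAt]
  simp only [tens, RCLike.inner_apply, map_mul, RCLike.star_def]
  ring

end

variable [∀ k, DecidableEq (d k)]

/-- Exchanging the `k`-th factors interchanges the two terms of the difference, hence the sign; when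
the operator acts on another factor, nothing moves. -/
theorem copyDiff_embed_submatrix_same (k : Fin N) (A : Matrix (d k) (d k) ℂ) :
    (copyDiff (embed k A)).submatrix (swapAt k) (swapAt k) = -copyDiff (embed k A) := by
  rw [copyDiff, ← tensor_one, embed, Matrix.submatrix_sub, Pi.sub_apply, Pi.sub_apply,
    tensor_kronecker_submatrix_swapAt, tensor_kronecker_submatrix_swapAt]
  simp

theorem copyDiff_embed_submatrix_of_ne {k l : Fin N} (hkl : k ≠ l) (A : Matrix (d l) (d l) ℂ) :
    (copyDiff (embed l A)).submatrix (swapAt k) (swapAt k) = copyDiff (embed l A) := by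
  rw [copyDiff, ← tensor_one, embed, Matrix.submatrix_sub, Pi.sub_apply, Pi.sub_apply,
    tensor_kronecker_submatrix_swapAt, tensor_kronecker_submatrix_swapAt]
  have h : Function.update (Function.update (fun l => (1 : Matrix (d l) (d l) ℂ)) l A) k 1 =
      Function.update (fun l => (1 : Matrix (d l) (d l) ℂ)) l A :=
    Function.update_eq_self_iff.2 (by rw [Function.update_of_ne hkl])
  simp [Function.update_of_ne hkl, h]

variable [∀ k, Fintype (d k)]

theorem toEuclideanLin_swapOp {k : Fin N}
    {M M' : Matrix ((∀ k, d k) × (∀ k, d k)) ((∀ k, d k) × (∀ k, d k)) ℂ}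
    (h : M.submatrix (swapAt k) (swapAt k) = M')
    (v : EuclideanSpace ℂ ((∀ k, d k) × (∀ k, d k))) :
    M.toEuclideanLin (swapOp k v) = swapOp k (M'.toEuclideanLin v) := by
  rw [← swapOp_swapOp k (M.toEuclideanLin _)]
  congr 1
  ext p
  rw [← h, swapOp_apply, Matrix.toLpLin_apply, Matrix.toLpLin_apply]
  change _ = (M.submatrix (swapAt k) (swapAt k) *ᵥ v.ofLp) p
  rw [Matrix.submatrix_mulVec_equiv]
  rfl

end Swap

/-! ### Purity and entropy -/

section Entropy

variable {n : Type*} [Fintype n] [DecidableEq n]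

theorem DensityMatrix.trace_mul_self (ρ : DensityMatrix n) :
    (ρ.mat * ρ.mat).trace = ((∑ i, ρ.eig i ^ 2 : ℝ) : ℂ) := by
  rw [trace_mul_eq_sum_eig]
  push_cast
  refine Finset.sum_congr rfl fun i _ => ?_
  rw [toEuclideanLin_eigBasis, inner_smul_right, inner_self_eq_norm_sq_to_K,
    ρ.eigBasis.orthonormal.1]
  simp [sq]

/-- The linear entropy is at most the von Neumann entropy. -/
theorem DensityMatrix.one_sub_sum_eig_sq_le_entropy (ρ : DensityMatrix n) :
    1 - ∑ i, ρ.eig i ^ 2 ≤ ρ.entropy := by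
  rw [← ρ.sum_eig, ← Finset.sum_sub_distrib]
  refine Finset.sum_le_sum fun i _ => ?_
  rw [Real.negMulLog]
  rcases (ρ.eig_nonneg i).eq_or_lt with h | h
  · simp [← h]
  -- Multiplying `ln λ ≤ λ - 1` by `λ` gives `λ - λ² ≤ -λ ln λ`.
  · nlinarith [Real.log_le_sub_one_of_pos h]

end Entropy

/-! ### Covariance bounded by entropy -/

section Covariance

variable {N : ℕ} {d : Fin N → Type*} [∀ k, Fintype (d k)] [∀ k, DecidableEq (d k)]

/-- The expectation of `A` on the `k`-th factor. -/
noncomputable def localMean (ψ : PureState (∀ k, d k)) (k : Fin N) (A : Matrix (d k) (d k) ℂ) : ℝ :=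
  (inner ℂ ψ.vec ((embed k A).toEuclideanLin ψ.vec)).re

/-- The vector `(A - ⟨A⟩)ψ`, for `A` acting on the `k`-th factor. -/
noncomputable def deviation (ψ : PureState (∀ k, d k)) (k : Fin N) (A : Matrix (d k) (d k) ℂ) :
    EuclideanSpace ℂ (∀ k, d k) :=
  (embed k A).toEuclideanLin ψ.vec - (localMean ψ k A : ℂ) • ψ.vec

theorem re_inner_deviation (ψ : PureState (∀ k, d k)) (k l : Fin N) {A : Matrix (d k) (d k) ℂ}
    (hA : A.IsHermitian) (B : Matrix (d l) (d l) ℂ) :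
    (inner ℂ (deviation ψ k A) (deviation ψ l B)).re =
      (inner ℂ ((embed k A).toEuclideanLin ψ.vec) ((embed l B).toEuclideanLin ψ.vec)).re -
        localMean ψ k A * localMean ψ l B := by
  simp only [deviation, inner_sub_left, inner_sub_right, inner_smul_left, inner_smul_right,
    Complex.conj_ofReal, Complex.sub_re, Complex.re_ofReal_mul, inner_self_eq_norm_sq_to_K,
    ψ.norm_eq_one, IsHermitian.inner_toEuclideanLin (embed_isHermitian k hA) ψ.vec ψ.vec]
  simp only [localMean]
  simp

theorem norm_deviation_sq_le (ψ : PureState (∀ k, d k)) (k : Fin N) {A : Matrix (d k) (d k) ℂ}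
    (hA : A.IsHermitian) :
    ‖deviation ψ k A‖ ^ 2 ≤ ‖(embed k A).toEuclideanLin ψ.vec‖ ^ 2 := by
  have h := re_inner_deviation ψ k k hA A
  have e : ∀ x : EuclideanSpace ℂ (∀ k, d k), (inner ℂ x x).re = ‖x‖ ^ 2 := fun x =>
    inner_self_eq_norm_sq (𝕜 := ℂ) x
  rw [e, e] at h
  nlinarith [sq_nonneg (localMean ψ k A)]

/-- The covariance of two centred local observables of a pure state is controlled by the entropy
of one of the two factors. -/
theorem covariance_le (ψ : PureState (∀ k, d k)) {k l : Fin N} (hkl : k ≠ l)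
    {A G : Matrix (d k) (d k) ℂ} {B K : Matrix (d l) (d l) ℂ} {a b : ℝ} (ha : 0 ≤ a) (hb : 0 ≤ b)
    (hA : A.IsHermitian) (hB : B.IsHermitian)
    (hAG : Aᴴ * A + Gᴴ * G = ((a ^ 2 : ℝ) : ℂ) • 1)
    (hBK : Bᴴ * B + Kᴴ * K = ((b ^ 2 : ℝ) : ℂ) • 1) :
    (inner ℂ (deviation ψ k A) (deviation ψ l B)).re ≤
      2 * a * b * √((ψ.toDensity.reduced k).entropy) := by
  set v := ψ.vec with hv
  set Ψ := tens v v with hΨ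
  set DA := copyDiff (embed k A)
  set DB := copyDiff (embed l B)
  set s := (ψ.toDensity.reduced k).entropy
  have hA' := embed_isHermitian k hA
  have hB' := embed_isHermitian l hB
  have hself : ∀ x : EuclideanSpace ℂ ((∀ k, d k) × (∀ k, d k)), (inner ℂ x x).re = ‖x‖ ^ 2 :=
    fun x => inner_self_eq_norm_sq (𝕜 := ℂ) x
  have hΨ1 : ‖Ψ‖ ^ 2 = 1 := by
    rw [← hself, hΨ, inner_tens, inner_self_eq_norm_sq_to_K, hv, ψ.norm_eq_one]
    simp
  -- `DA` anticommutes with the swap of factor `k`, and `DB` commutes with it since `l ≠ k`.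
  have hcov : (inner ℂ (DA.toEuclideanLin Ψ) (DB.toEuclideanLin (Ψ - swapOp k Ψ))).re =
      2 * (inner ℂ (deviation ψ k A) (deviation ψ l B)).re := by
    rw [re_inner_deviation ψ k l hA B, localMean, localMean,
      ← copyDiff_inner_tens_self hA' hB' ψ.norm_eq_one]
    refine re_inner_anticomm (F := (swapOp (d := d) k).toLinearEquiv.toLinearMap)
      (Matrix.isSymmetric_toEuclideanLin_iff.2 (copyDiff_isHermitian hA'))
      (Matrix.isSymmetric_toEuclideanLin_iff.2 (copyDiff_isHermitian hB'))
      (swapOp_isSymmetric k) (fun x => ?_) (fun x => ?_) (fun x => ?_) Ψ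
    · rw [← LinearMap.comp_apply, ← LinearMap.comp_apply, ← Matrix.toLpLin_mul_same,
        ← Matrix.toLpLin_mul_same, copyDiff_comm (embed_comm hkl A B)]
    · refine (toEuclideanLin_swapOp (copyDiff_embed_submatrix_same k A) x).trans ?_
      rw [map_neg, LinearMap.neg_apply, map_neg]
      rfl
    · exact toEuclideanLin_swapOp (copyDiff_embed_submatrix_of_ne hkl B) x
  -- On a product of two equal vectors the squared norm is twice a variance, which improves the
  -- general bound `2a` to `√2 a`.
  have hDA : ‖DA.toEuclideanLin Ψ‖ ^ 2 ≤ 2 * a ^ 2 := by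
    rw [← hself, copyDiff_inner_tens_self hA' hA' ψ.norm_eq_one]
    have h1 := norm_embed_le ha hAG v
    rw [hv, ψ.norm_eq_one, mul_one] at h1
    have h2 : (inner ℂ ((embed k A).toEuclideanLin v) ((embed k A).toEuclideanLin v)).re =
      ‖(embed k A).toEuclideanLin v‖ ^ 2 := inner_self_eq_norm_sq (𝕜 := ℂ) _
    rw [h2]
    nlinarith [pow_le_pow_left₀ (norm_nonneg _) h1 2,
      mul_self_nonneg (inner ℂ v ((embed k A).toEuclideanLin v)).re]
  -- The squared norm is `2 - 2 Tr ρₖ²`, twice the linear entropy.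
  have hanti : ‖Ψ - swapOp k Ψ‖ ^ 2 ≤ 2 * s := by
    rw [@norm_sub_sq ℂ, LinearIsometryEquiv.norm_map, hΨ1, hΨ, inner_swapOp_tens,
      DensityMatrix.trace_mul_self]
    have := (ψ.toDensity.reduced k).one_sub_sum_eig_sq_le_entropy
    rw [RCLike.re_to_complex, Complex.ofReal_re]
    linarith
  have hDA' : ‖DA.toEuclideanLin Ψ‖ ≤ √2 * a := by
    refine abs_le_of_sq_le_sq' ?_ (by positivity) |>.2
    rwa [mul_pow, Real.sq_sqrt zero_le_two]
  have hanti' : ‖Ψ - swapOp k Ψ‖ ≤ √2 * √s := by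
    rw [← Real.sqrt_mul zero_le_two]
    exact Real.le_sqrt_of_sq_le hanti
  have hDB := (norm_copyDiff_le hb (C := embed l B) (G := embed l K) (by
    rw [embed_conjTranspose, embed_conjTranspose, embed_mul, embed_mul, ← embed_add, hBK,
      embed_smul, embed_one]) (Ψ - swapOp k Ψ)).trans
    (mul_le_mul_of_nonneg_left hanti' (by positivity))
  have hCS := (re_inner_le_norm (𝕜 := ℂ) (DA.toEuclideanLin Ψ)
    (DB.toEuclideanLin (Ψ - swapOp k Ψ))).trans
    (mul_le_mul hDA' hDB (norm_nonneg _) (by positivity))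
  rw [RCLike.re_to_complex, hcov] at hCS
  have h2 : √2 * √2 = (2 : ℝ) := Real.mul_self_sqrt zero_le_two
  have e : √2 * a * (2 * b * (√2 * √s)) = 2 * (2 * a * b * √s) := by
    linear_combination 2 * a * b * √s * h2
  linarith

end Covariance

/-! ### Summation over factors, decompositions and the infimum -/

section Main

variable {N : ℕ} {d : Fin N → Type*} [∀ k, DecidableEq (d k)]

theorem totalHamiltonian_eq_sum_embed (H : ∀ k, Matrix (d k) (d k) ℂ) :
    totalHamiltonian H = ∑ k, embed k (H k) := rfl

theorem totalHamiltonian_isHermitian {H : ∀ k, Matrix (d k) (d k) ℂ}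
    (hH : ∀ k, (H k).IsHermitian) : (totalHamiltonian H).IsHermitian := by
  rw [totalHamiltonian_eq_sum_embed, Matrix.IsHermitian, Matrix.conjTranspose_sum]
  exact Finset.sum_congr rfl fun k _ => embed_isHermitian k (hH k)

variable [∀ k, Fintype (d k)]

/-- The double sum factors as `(∑ Δₖ√sₖ)(∑ Δₗ)`, and Cauchy–Schwarz applies to each factor. -/
theorem sum_sum_mul_sqrt_le {N : ℕ} (Δ s : Fin N → ℝ) (hs : ∀ k, 0 ≤ s k) :
    ∑ k, ∑ l, Δ k * Δ l * √(s k) ≤ (∑ k, Δ k ^ 2) * √(N * ∑ k, s k) := by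
  have h0 : 0 ≤ ∑ k, Δ k ^ 2 := Finset.sum_nonneg fun k _ => sq_nonneg _
  have e : ∑ k, ∑ l, Δ k * Δ l * √(s k) = (∑ k, Δ k * √(s k)) * ∑ l, Δ l * 1 := by
    rw [Finset.sum_mul_sum]
    exact Finset.sum_congr rfl fun k _ => Finset.sum_congr rfl fun l _ => by ring
  have h1 := Finset.sum_mul_sq_le_sq_mul_sq Finset.univ Δ fun k => √(s k)
  have h2 := Finset.sum_mul_sq_le_sq_mul_sq Finset.univ Δ fun _ => 1
  have h3 : ∑ k, √(s k) ^ 2 = ∑ k, s k := Finset.sum_congr rfl fun k _ => Real.sq_sqrt (hs k)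
  have h4 : 0 ≤ ∑ k, s k := Finset.sum_nonneg fun k _ => hs k
  rw [h3] at h1
  rw [e]
  refine abs_le_of_sq_le_sq' ?_ (by positivity) |>.2
  rw [mul_pow, mul_pow, Real.sq_sqrt (by positivity)]
  refine (mul_le_mul h1 h2 (sq_nonneg _) (by positivity)).trans (le_of_eq ?_)
  simp only [one_pow, Finset.sum_const, Finset.card_univ, Fintype.card_fin, nsmul_eq_mul, mul_one]
  ring

/-- A pure state has, about a suitable centre, small variance of the total Hamiltonian. -/
theorem exists_variance_le (hd : ∀ k, Nonempty (d k)) {H : ∀ k, Matrix (d k) (d k) ℂ}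
    (hH : ∀ k, (H k).IsHermitian) (ψ : PureState (∀ k, d k)) :
    ∃ h : ℝ, 4 * ‖(totalHamiltonian H).toEuclideanLin ψ.vec - (h : ℂ) • ψ.vec‖ ^ 2 ≤
      avg (fun k => spread (hH k) ^ 2) *
        (N + 2 * (N : ℝ) ^ 2 * √(avg fun k => (ψ.toDensity.reduced k).entropy)) := by
  set s : Fin N → ℝ := fun k => (ψ.toDensity.reduced k).entropy with hs
  set Δ : Fin N → ℝ := fun k => spread (hH k) with hΔ
  have hs0 : ∀ k, 0 ≤ s k := fun k => (ψ.toDensity.reduced k).entropy_nonneg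
  have hΔ0 : ∀ k, 0 ≤ Δ k := fun k => spread_nonneg (hH k)
  set w : Fin N → EuclideanSpace ℂ (∀ k, d k) := fun k => deviation ψ k (centred (hH k)) with hw
  -- The entropy term is allowed on the diagonal as well, where it is merely nonnegative, so that
  -- the double sum factors.
  have hterm : ∀ k l, (inner ℂ (w k) (w l)).re ≤
      (if k = l then Δ k ^ 2 / 4 else 0) + Δ k * Δ l * √(s k) / 2 := fun k l => by
    obtain ⟨G, hG⟩ := exists_centred_sq_add (hH k)
    obtain ⟨K, hK⟩ := exists_centred_sq_add (hH l)
    have ha : 0 ≤ spread (hH k) / 2 := div_nonneg (hΔ0 k) zero_le_two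
    have hb : 0 ≤ spread (hH l) / 2 := div_nonneg (hΔ0 l) zero_le_two
    split_ifs with hkl
    · subst hkl
      have h1 : (inner ℂ (w k) (w k)).re = ‖w k‖ ^ 2 := inner_self_eq_norm_sq (𝕜 := ℂ) _
      have h2 := norm_deviation_sq_le ψ k (centred_isHermitian (hH k))
      have h3 := pow_le_pow_left₀ (norm_nonneg _) (norm_embed_le ha hG ψ.vec) 2
      rw [ψ.norm_eq_one, mul_one] at h3
      have h4 : 0 ≤ Δ k * Δ k * √(s k) / 2 := by have := hΔ0 k; positivity
      rw [h1]
      calc ‖w k‖ ^ 2 ≤ (spread (hH k) / 2) ^ 2 := h2.trans h3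
        _ = Δ k ^ 2 / 4 := by ring
        _ ≤ _ := le_add_of_nonneg_right h4
    · refine (covariance_le ψ hkl ha hb (centred_isHermitian (hH k)) (centred_isHermitian (hH l))
        hG hK).trans (le_of_eq ?_)
      simp only [hΔ, hs]
      ring
  -- This centre is the mean of the total Hamiltonian in `ψ`.
  refine ⟨∑ k, (midpt (hH k) + localMean ψ k (centred (hH k))), ?_⟩
  have hsum : (totalHamiltonian H).toEuclideanLin ψ.vec -
      ((∑ k, (midpt (hH k) + localMean ψ k (centred (hH k))) : ℝ) : ℂ) • ψ.vec = ∑ k, w k := by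
    rw [totalHamiltonian_eq_sum_embed, map_sum, LinearMap.sum_apply, Complex.ofReal_sum,
      Finset.sum_smul, ← Finset.sum_sub_distrib]
    refine Finset.sum_congr rfl fun k _ => ?_
    have e : embed k (H k) = embed k (centred (hH k)) + (midpt (hH k) : ℂ) • 1 := by
      conv_lhs => rw [← sub_add_cancel (H k) ((midpt (hH k) : ℂ) • 1)]
      rw [embed_add, embed_smul, embed_one, centred]
    simp only [hw, deviation]
    rw [e, map_add, LinearMap.add_apply, map_smul, LinearMap.smul_apply, Matrix.toLpLin_one,
      LinearMap.id_apply]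
    push_cast
    module
  have hnorm : ‖∑ k, w k‖ ^ 2 ≤
      ∑ k, ∑ l, ((if k = l then Δ k ^ 2 / 4 else 0) + Δ k * Δ l * √(s k) / 2) := by
    have h1 : (inner ℂ (∑ k, w k) (∑ k, w k)).re = ‖∑ k, w k‖ ^ 2 :=
      inner_self_eq_norm_sq (𝕜 := ℂ) _
    rw [← h1, sum_inner, Complex.re_sum]
    refine Finset.sum_le_sum fun k _ => ?_
    rw [inner_sum, Complex.re_sum]
    exact Finset.sum_le_sum fun l _ => hterm k l
  rw [hsum]
  have hCS := sum_sum_mul_sqrt_le Δ s hs0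
  have hsplit : ∑ k, ∑ l, ((if k = l then Δ k ^ 2 / 4 else 0) + Δ k * Δ l * √(s k) / 2) =
      (∑ k, Δ k ^ 2) / 4 + (∑ k, ∑ l, Δ k * Δ l * √(s k)) / 2 := by
    simp only [Finset.sum_add_distrib, Finset.sum_ite_eq, Finset.mem_univ, if_true,
      ← Finset.sum_div]
  rw [hsplit] at hnorm
  have hrhs : avg (fun k => Δ k ^ 2) * (N + 2 * (N : ℝ) ^ 2 * √(avg s)) =
      (∑ k, Δ k ^ 2) + 2 * ((∑ k, Δ k ^ 2) * √(N * ∑ k, s k)) := by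
    -- For `N = 0` the average is `0 / 0 = 0` and both sides vanish.
    rcases Nat.eq_zero_or_pos N with h | h
    · subst h; simp [avg]
    · have hN : (0 : ℝ) < N := Nat.cast_pos.2 h
      have : √(N * ∑ k, s k) = N * √(avg s) := by
        rw [← Real.sqrt_sq hN.le, ← Real.sqrt_mul (sq_nonneg _), Real.sqrt_sq hN.le, avg]
        congr 1
        field_simp
      rw [this, avg]
      field_simp
  rw [hrhs]
  linarith

/-- Jensen's inequality for the square root, as Cauchy–Schwarz for `√pᵢ` and `√pᵢ√xᵢ`. -/
theorem sum_mul_sqrt_le {ι : Type*} [Fintype ι] {p x : ι → ℝ} (hp : ∀ i, 0 ≤ p i)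
    (hp1 : ∑ i, p i = 1) (hx : ∀ i, 0 ≤ x i) : ∑ i, p i * √(x i) ≤ √(∑ i, p i * x i) := by
  have h := Real.sum_mul_le_sqrt_mul_sqrt Finset.univ (fun i => √(p i)) fun i => √(p i) * √(x i)
  simp only [mul_pow, Real.sq_sqrt (hp _), Real.sq_sqrt (hx _), hp1, Real.sqrt_one, one_mul,
    ← mul_assoc, Real.mul_self_sqrt (hp _)] at h
  exact h

theorem qfi_totalHamiltonian_le_cost (hd : ∀ k, Nonempty (d k)) {H : ∀ k, Matrix (d k) (d k) ℂ}
    (hH : ∀ k, (H k).IsHermitian) {ρ : DensityMatrix (∀ k, d k)} (D : ρ.PureDecomposition) :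
    ρ.qfi (totalHamiltonian H) ≤
      avg (fun k => spread (hH k) ^ 2) * (N + 2 * (N : ℝ) ^ 2 * √D.cost) := by
  choose h hh using fun l => exists_variance_le hd hH (D.ψ l)
  have hF : 0 ≤ avg fun k => spread (hH k) ^ 2 :=
    div_nonneg (Finset.sum_nonneg fun k _ => sq_nonneg _) (Nat.cast_nonneg N)
  refine (D.qfi_le (totalHamiltonian_isHermitian hH) h).trans ?_
  refine (Finset.sum_le_sum fun l _ => mul_le_mul_of_nonneg_left (hh l) (D.p_nonneg l)).trans ?_
  have hJ := sum_mul_sqrt_le D.p_nonneg D.p_sum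
    (x := fun l => avg fun k => ((D.ψ l).toDensity.reduced k).entropy)
    fun l => div_nonneg (Finset.sum_nonneg fun k _ => DensityMatrix.entropy_nonneg _)
      (Nat.cast_nonneg N)
  calc _ = avg (fun k => spread (hH k) ^ 2) * (N * ∑ l, D.p l + 2 * (N : ℝ) ^ 2 *
        ∑ l, D.p l * √(avg fun k => ((D.ψ l).toDensity.reduced k).entropy)) := by
        rw [Finset.mul_sum, Finset.mul_sum, ← Finset.sum_add_distrib, Finset.mul_sum]
        exact Finset.sum_congr rfl fun l _ => by ring
    _ ≤ _ := by
        rw [D.p_sum, mul_one]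
        gcongr
        exact hJ

end Main

end QInfo

theorem mainTheorem3 {N : ℕ} {d : Fin N → Type*} [∀ k, Fintype (d k)] [∀ k, DecidableEq (d k)]
    (H : ∀ k, Matrix (d k) (d k) ℂ) (hH : ∀ k, (H k).IsHermitian)
    (ρ : DensityMatrix (∀ k, d k)) :
    (∀ k, IsGreatest (Set.range fun σ : DensityMatrix (d k) => σ.qfi (H k)) (qfiMax (H k)) ∧
      qfiMax (H k) = ((⨆ i, (hH k).eigenvalues i) - ⨅ i, (hH k).eigenvalues i) ^ 2) ∧
    ρ.qfi (totalHamiltonian H) ≤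
      avg (fun k => qfiMax (H k)) * (N + 2 * (N : ℝ) ^ 2 * √(entanglementMF ρ)) := by
  have hd : ∀ k, Nonempty (d k) := fun k => ρ.nonempty.map fun x => x k
  refine ⟨fun k => ⟨?_, DensityMatrix.qfiMax_eq (hH k)⟩, ?_⟩
  · rw [DensityMatrix.qfiMax_eq (hH k)]
    exact DensityMatrix.isGreatest_qfi (hH k)
  simp only [DensityMatrix.qfiMax_eq (hH _)]
  -- The infimum need not be known to be attained: the bound is a closed condition on the cost, and
  -- the infimum lies in the closure of the set of costs.
  have hclosed : IsClosed {x : ℝ | ρ.qfi (totalHamiltonian H) ≤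
      avg (fun k => spread (hH k) ^ 2) * (N + 2 * (N : ℝ) ^ 2 * √x)} :=
    isClosed_le continuous_const (by fun_prop)
  refine hclosed.closure_subset_iff.2 ?_
    ((isGLB_entanglementMF ρ).mem_closure (Set.range_nonempty _))
  rintro _ ⟨D, rfl⟩
  exact qfi_totalHamiltonian_le_cost hd hH D
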